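/- For every pair of integers $g \ge 3$ and $k \ge 1$ there is a finite set of straight (infinite) lines in $\mathbb{R}^3$ whose intersection graph has girth at least $g$ and chromatic number at least $k$. Here the intersection graph of a set of lines has the lines as its vertices, two distinct lines being adjacent if and only if they have a point in common; the girth of a graph is the length of its shortest cycle, and is $\infty$ if the graph has no cycle. -/

import Mathlib

/-- The intersection graph of a family `S` of sets: its vertices are the members of `S`, and two
distinct members are adjacent exactly when they have a point in common. -/
def intersectionGraph {α : Type*} (S : Set (Set α)) : SimpleGraph S where
  Adj A B := A ≠ B ∧ ((A : Set α) ∩ (B : Set α)).Nonempty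
  symm := ⟨fun A B h => ⟨h.1.symm, by rw [Set.inter_comm]; exact h.2⟩⟩
  loopless := ⟨fun _ h => h.1 rfl⟩

/-- A subset of `ℝ³` is a straight (infinite) line when it is the affine span of two distinct
points. -/
def IsStraightLine (L : Set (EuclideanSpace ℝ (Fin 3))) : Prop :=
  ∃ p q : EuclideanSpace ℝ (Fin 3), p ≠ q ∧ L = (affineSpan ℝ {p, q} : Set _)

/-! Non-horizontal lines are world lines of points moving uniformly in the plane `ℂ`, and two lines
meet exactly when the points collide. Induct on the number of colors. Given a family of moving
points with distinct starting points, take a sparse hypergraph drawn in the plane whose edges are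
complex-affine images of the set of starting points, and in which every coloring of the vertices has
a monochromatic edge. Put a stationary point (a hub) at each vertex and, for each edge, launch a
scaled copy of the family so that at one moment it occupies the vertices of that edge. A common
extra velocity `m` keeps the collisions inside a copy; generic `m` and launch times exclude every
unintended collision (`exists_collisionGraph_eq_hubGraph`). The color of a monochromatic edge of
hubs is unavailable on its copy, so one more color is needed, while short cycles are excluded by
sparsity.

The hypergraph comes from `exists_sparse_copySystem`. Instead of being drawn, it carries a space of
functions restricting to each edge as elements of `A`; for `A` spanned by 1 and the starting points,
a generic such function is the drawing. Hales–Jewett gives the Ramsey property without sparsity. The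
partite construction, gluing copies along one fibre at a time, then doubles the girth bound; this
works because compatible functions extend over the glued copies (`IsCopySystem.glue`). -/

/-! ### Locally forest-like hypergraphs -/

section LocallyForest

variable {X Y E : Type}

/-- The vertex `edge e x` of the edge `e` lies on another edge of the finite family `F`. -/
def IsSharedVertex (edge : E → X → Y) (F : Finset E) (e : E) (x : X) : Prop :=
  ∃ e' ∈ F, e' ≠ e ∧ ∃ x', edge e' x' = edge e x

/-- Every nonempty family of at most `g` edges has an edge which shares at most one vertex with the
other edges of the family. For hypergraphs with injectively parametrized edges this says that the
hypergraph has no (Berge) cycle of length at most `g`. -/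
def LocallyForest (edge : E → X → Y) (g : ℕ) : Prop :=
  ∀ F : Finset E, F.Nonempty → F.card ≤ g → ∃ e ∈ F, {x | IsSharedVertex edge F e x}.Subsingleton

theorem LocallyForest.mono {edge : E → X → Y} {g g' : ℕ} (h : LocallyForest edge g')
    (hg : g ≤ g') : LocallyForest edge g :=
  fun F hF hcard => h F hF (hcard.trans hg)

/-- A locally forest-like hypergraph has leaves away from any prescribed vertex. -/
theorem LocallyForest.exists_leaf {edge : E → X → Y} {g : ℕ} (h : LocallyForest edge g)
    (hinj : ∀ e, Function.Injective (edge e)) (F : Finset E) (hF : F.Nonempty) (hcard : F.card ≤ g)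
    (Q : Set Y) (hQ : Q.Subsingleton) :
    ∃ e ∈ F, {x | edge e x ∈ Q ∨ IsSharedVertex edge F e x}.Subsingleton := by
  classical
  induction F using Finset.strongInduction generalizing Q with
  | H F ih =>
    obtain ⟨e, heF, he⟩ := h F hF hcard
    by_cases hok : {x | edge e x ∈ Q ∨ IsSharedVertex edge F e x}.Subsingleton
    · exact ⟨e, heF, hok⟩
    have key : ∃ q s, edge e q ∈ Q ∧ ¬ IsSharedVertex edge F e q ∧ IsSharedVertex edge F e s := by
      simp only [Set.Subsingleton, not_forall] at hok
      obtain ⟨x, hx, y, hy, hxy⟩ := hok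
      by_cases hxs : IsSharedVertex edge F e x
      · by_cases hys : IsSharedVertex edge F e y
        · exact absurd (he hxs hys) hxy
        · exact ⟨y, x, hy.resolve_right hys, hys, hxs⟩
      · by_cases hys : IsSharedVertex edge F e y
        · exact ⟨x, y, hx.resolve_right hxs, hxs, hys⟩
        · exact absurd (hinj e (hQ (hx.resolve_right hxs) (hy.resolve_right hys))) hxy
    obtain ⟨q, s, hq, hqs, hs⟩ := key
    have hne : (F.erase e).Nonempty := by
      obtain ⟨e', he', hne, -⟩ := hs
      exact ⟨e', Finset.mem_erase.2 ⟨hne, he'⟩⟩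
    -- The leaf `e` carries the prescribed vertex at an unshared place, so no other edge contains
    -- it. After deleting `e`, the vertex to protect is the one where `e` was attached.
    obtain ⟨e', he', hsub⟩ := ih (F.erase e) (Finset.erase_ssubset heF) hne
      ((Finset.card_le_card (Finset.erase_subset _ _)).trans hcard) {edge e s}
      Set.subsingleton_singleton
    obtain ⟨hne', heF'⟩ := Finset.mem_erase.1 he'
    refine ⟨e', heF', hsub.anti ?_⟩
    rintro x (hx | ⟨e'', he'', hne'', x', hx'⟩)
    · exact absurd ⟨e', heF', hne', x, hQ hx hq⟩ hqs
    · by_cases h2 : e'' = e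
      · subst h2
        have : x' = s := he (show IsSharedVertex edge F e'' x' from ⟨e', heF', hne', x, hx'.symm⟩) hs
        subst this
        exact Or.inl hx'.symm
      · exact Or.inr ⟨e'', Finset.mem_erase.2 ⟨h2, he''⟩, hne'', x', hx'⟩

end LocallyForest

/-! ### Systems of copies -/

section CopySystem

variable {K : Type} [Field K] {X Y E : Type}

/-- A space of functions on `X` which contains the constants and separates points. -/
structure SeparatingWithConstants (A : Submodule K (X → K)) : Prop where
  const_mem (c : K) : (fun _ => c) ∈ A
  separates (x y : X) (hxy : x ≠ y) : ∃ a ∈ A, a x ≠ a y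

/-- The functions on the vertex set whose pullback along each edge lies in `A`. -/
def compatibleFunctions (A : Submodule K (X → K)) (edge : E → X → Y) : Submodule K (Y → K) where
  carrier := {u | ∀ e, u ∘ edge e ∈ A}
  add_mem' hu hv e := A.add_mem (hu e) (hv e)
  zero_mem' _ := A.zero_mem
  smul_mem' c _ hu e := A.smul_mem c (hu e)

/-- A hypergraph without short cycles, with edges parametrized by `X`, that has enough functions
whose restriction to every edge belongs to `A`. -/
structure IsCopySystem (A : Submodule K (X → K)) (edge : E → X → Y) (g : ℕ) : Prop where
  injective (e : E) : Function.Injective (edge e)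
  locallyForest : LocallyForest edge g
  extend (e : E) (a : X → K) (ha : a ∈ A) : ∃ u ∈ compatibleFunctions A edge, u ∘ edge e = a
  separates (y z : Y) (hyz : y ≠ z) : ∃ u ∈ compatibleFunctions A edge, u y ≠ u z

theorem IsCopySystem.mono {A : Submodule K (X → K)} {edge : E → X → Y} {g g' : ℕ}
    (h : IsCopySystem A edge g') (hg : g ≤ g') : IsCopySystem A edge g :=
  { h with locallyForest := h.locallyForest.mono hg }

theorem locallyForest_one (edge : E → X → Y) : LocallyForest edge 1 := by
  intro F hF hcard
  obtain ⟨e, rfl⟩ := Finset.card_eq_one.1 (le_antisymm hcard hF.card_pos)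
  refine ⟨e, by simp, ?_⟩
  rintro x ⟨e', he', hne, -⟩
  exact absurd (Finset.mem_singleton.1 he') hne

theorem SeparatingWithConstants.compatibleFunctions {A : Submodule K (X → K)}
    (hA : SeparatingWithConstants A) {edge : E → X → Y} {g : ℕ} (h : IsCopySystem A edge g) :
    SeparatingWithConstants (compatibleFunctions A edge) :=
  ⟨fun c _ => hA.const_mem c, h.separates⟩

/-- The Hales–Jewett theorem as a statement about systems of copies. -/
theorem exists_copySystem_one {κ : Type} [Finite κ] [Finite X] {A : Submodule K (X → K)}
    (hA : SeparatingWithConstants A) :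
    ∃ (Y E : Type) (_ : Finite Y) (_ : Finite E) (edge : E → X → Y),
      IsCopySystem A edge 1 ∧ ∀ c : Y → κ, ∃ e k, ∀ x, c (edge e x) = k := by
  obtain ⟨ι, _, hι⟩ := Combinatorics.Line.exists_mono_in_high_dimension X κ
  have hfin : Finite (Combinatorics.Line X ι) :=
    Finite.of_injective (fun l => l.idxFun) (by rintro ⟨a, _⟩ ⟨b, _⟩ rfl; rfl)
  -- Along a combinatorial line a coordinate is either active, giving back `a`, or fixed, giving a
  -- constant; hence the requirement that `A` contain the constants.
  have hcompat : ∀ a ∈ A, ∀ i : ι, (fun y : ι → X => a (y i)) ∈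
      compatibleFunctions A (fun (l : Combinatorics.Line X ι) x => l x) := by
    intro a ha i l
    cases hl : l.idxFun i with
    | none =>
      convert ha using 1
      funext x
      simp [hl]
    | some b =>
      convert hA.const_mem (a b) using 1
      funext x
      simp [hl]
  refine ⟨ι → X, Combinatorics.Line X ι, inferInstance, hfin, fun l x => l x,
    ⟨?_, locallyForest_one _, ?_, ?_⟩, hι⟩
  · intro l x y hxy
    obtain ⟨i, hi⟩ := l.proper
    have := congrFun hxy i
    simpa [hi] using this
  · intro l a ha
    obtain ⟨i, hi⟩ := l.proper
    refine ⟨_, hcompat a ha i, ?_⟩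
    funext x
    simp [hi]
  · intro y z hyz
    obtain ⟨i, hi⟩ := Function.ne_iff.1 hyz
    obtain ⟨a, ha, hne⟩ := hA.separates _ _ hi
    exact ⟨_, hcompat a ha i, hne⟩

end CopySystem

/-! ### Gluing copies of a system along a set of vertices -/

section Glue

variable {K X P E Y I : Type}

open Classical in
/-- The `i`-th copy of `P` in the vertex set obtained by gluing copies of `P` along the images
`f i` of `Z`. -/
noncomputable def glueMap (Z : Set P) (f : I → Z → Y) (i : I) (p : P) : Y ⊕ (I × ↥Zᶜ) :=
  if h : p ∈ Z then Sum.inl (f i ⟨p, h⟩) else Sum.inr (i, ⟨p, h⟩)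

/-- The function on the glued vertex set given by `u` on the glued part and by `v i` on the rest of
the `i`-th copy. -/
def glueFun (Z : Set P) (u : Y → K) (v : I → P → K) : Y ⊕ (I × ↥Zᶜ) → K :=
  Sum.elim u fun q => v q.1 q.2

/-- The edges of the glued hypergraph. -/
noncomputable def glueEdge (Z : Set P) (f : I → Z → Y) (edge : E → X → P) (q : I × E) (x : X) :
    Y ⊕ (I × ↥Zᶜ) :=
  glueMap Z f q.1 (edge q.2 x)

theorem glueMap_of_mem {Z : Set P} {f : I → Z → Y} {i : I} {p : P} (h : p ∈ Z) :
    glueMap Z f i p = Sum.inl (f i ⟨p, h⟩) := dif_pos h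

theorem glueMap_of_notMem {Z : Set P} {f : I → Z → Y} {i : I} {p : P} (h : p ∉ Z) :
    glueMap Z f i p = Sum.inr (i, ⟨p, h⟩) := dif_neg h

theorem glueMap_injective {Z : Set P} {f : I → Z → Y} {i : I} (hf : Function.Injective (f i)) :
    Function.Injective (glueMap Z f i) := by
  intro p q hpq
  by_cases hp : p ∈ Z <;> by_cases hq : q ∈ Z
  · simpa [glueMap_of_mem hp, glueMap_of_mem hq, hf.eq_iff] using hpq
  · simp [glueMap_of_mem hp, glueMap_of_notMem hq] at hpq
  · simp [glueMap_of_notMem hp, glueMap_of_mem hq] at hpq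
  · simpa [glueMap_of_notMem hp, glueMap_of_notMem hq] using hpq

theorem mem_of_glueMap_eq {Z : Set P} {f : I → Z → Y} {i j : I} {p q : P} (hij : i ≠ j)
    (h : glueMap Z f i p = glueMap Z f j q) :
    ∃ (hp : p ∈ Z) (hq : q ∈ Z), f i ⟨p, hp⟩ = f j ⟨q, hq⟩ := by
  by_cases hp : p ∈ Z <;> by_cases hq : q ∈ Z
  · exact ⟨hp, hq, by simpa [glueMap_of_mem hp, glueMap_of_mem hq] using h⟩
  · simp [glueMap_of_mem hp, glueMap_of_notMem hq] at h
  · simp [glueMap_of_notMem hp, glueMap_of_mem hq] at h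
  · simp [glueMap_of_notMem hp, glueMap_of_notMem hq, hij] at h

theorem glueFun_glueMap {Z : Set P} {f : I → Z → Y} {u : Y → K} {v : I → P → K} {i : I}
    (huv : ∀ z : Z, v i z = u (f i z)) (p : P) : glueFun Z u v (glueMap Z f i p) = v i p := by
  by_cases hp : p ∈ Z
  · rw [glueMap_of_mem hp]
    exact (huv ⟨p, hp⟩).symm
  · rw [glueMap_of_notMem hp]
    rfl

variable [Field K]

/-- Each glued edge lies in a single copy, so compatibility only has to be tested copy by copy once
the pieces agree on `Z`. -/
theorem glueFun_mem {A : Submodule K (X → K)} {edge : E → X → P} {Z : Set P} {f : I → Z → Y}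
    {u : Y → K} {v : I → P → K} (huv : ∀ i, ∀ z : Z, v i z = u (f i z))
    (hv : ∀ i, v i ∈ compatibleFunctions A edge) :
    glueFun Z u v ∈ compatibleFunctions A (glueEdge Z f edge) := by
  rintro ⟨i, e⟩
  convert hv i e using 1
  funext x
  exact glueFun_glueMap (huv i) _

/-- The restrictions to `Z` of the functions in `B`. -/
def restrictFunctions (B : Submodule K (P → K)) (Z : Set P) : Submodule K (Z → K) :=
  B.map (LinearMap.funLeft K K Subtype.val)

theorem mem_restrictFunctions {B : Submodule K (P → K)} {Z : Set P} {a : Z → K} :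
    a ∈ restrictFunctions B Z ↔ ∃ v ∈ B, ∀ z : Z, v z = a z := by
  simp only [restrictFunctions, Submodule.mem_map]
  exact exists_congr fun v => and_congr_right fun _ => funext_iff

theorem SeparatingWithConstants.restrict {B : Submodule K (P → K)}
    (hB : SeparatingWithConstants B) (Z : Set P) :
    SeparatingWithConstants (restrictFunctions B Z) := by
  refine ⟨fun c => mem_restrictFunctions.2 ⟨_, hB.const_mem c, fun _ => rfl⟩, fun x y hxy => ?_⟩
  obtain ⟨a, ha, hne⟩ := hB.separates x y (Subtype.coe_ne_coe.2 hxy)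
  exact ⟨fun z => a z, mem_restrictFunctions.2 ⟨a, ha, fun _ => rfl⟩, hne⟩

/-- Gluing along a transversal set of vertices doubles the range in which the hypergraph is a
forest. -/
theorem LocallyForest.glue {edge : E → X → P} {g : ℕ} (hedge : ∀ e, Function.Injective (edge e))
    (hforest : LocallyForest edge (2 * g)) {Z : Set P} (hZ : ∀ e, {x | edge e x ∈ Z}.Subsingleton)
    {f : I → Z → Y} (hf : ∀ i, Function.Injective (f i)) (hfforest : LocallyForest f g) :
    LocallyForest (glueEdge Z f edge) (2 * g) := by
  classical
  intro F hF hcard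
  set fib : I → Finset (I × E) := fun i => F.filter fun q => q.1 = i with hfib
  -- An edge alone in its copy meets the other copies only inside `Z`, hence in at most one vertex.
  by_cases hone : ∃ i ∈ F.image Prod.fst, (fib i).card ≤ 1
  · obtain ⟨i, hi, hc⟩ := hone
    obtain ⟨⟨i, e⟩, hqF, rfl⟩ := Finset.mem_image.1 hi
    refine ⟨(i, e), hqF, (hZ e).anti ?_⟩
    rintro x ⟨⟨j, e'⟩, hF', hne, x', hx'⟩
    by_cases hij : j = i
    · subst hij
      exact absurd (Finset.card_le_one.1 hc _ (Finset.mem_filter.2 ⟨hF', rfl⟩) _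
        (Finset.mem_filter.2 ⟨hqF, rfl⟩)) hne
    · exact (mem_of_glueMap_eq hij hx').2.1
  · push Not at hone
    -- Otherwise every copy in use contributes at least two edges, so at most `g` copies occur and
    -- sparsity of `f` applies. This is the source of the doubling.
    have hle : 2 * (F.image Prod.fst).card ≤ F.card := by
      have := Finset.card_nsmul_le_sum (F.image Prod.fst) (fun i => (fib i).card) 2
        fun i hi => hone i hi
      rwa [← Finset.card_eq_sum_card_image Prod.fst F, smul_eq_mul, mul_comm] at this
    obtain ⟨i, hi, hleaf⟩ := hfforest (F.image Prod.fst) (hF.image _) (by omega)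
    have hQ : (Subtype.val '' {z : Z | IsSharedVertex f (F.image Prod.fst) i z}).Subsingleton :=
      hleaf.image _
    set G : Finset E := (fib i).image Prod.snd with hG
    have hmemG : ∀ e, e ∈ G ↔ (i, e) ∈ F := by
      intro e
      simp [hG, hfib]
    have hGne : G.Nonempty := by
      obtain ⟨⟨i, e⟩, hqF, rfl⟩ := Finset.mem_image.1 hi
      exact ⟨e, (hmemG e).2 hqF⟩
    have hGcard : G.card ≤ 2 * g :=
      (Finset.card_image_le.trans (Finset.card_filter_le _ _)).trans hcard
    obtain ⟨e, heG, hsub⟩ := hforest.exists_leaf hedge G hGne hGcard _ hQ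
    refine ⟨(i, e), (hmemG e).1 heG, hsub.anti ?_⟩
    rintro x ⟨⟨j, e'⟩, hF', hne, x', hx'⟩
    by_cases hij : j = i
    · subst hij
      refine Or.inr ⟨e', (hmemG e').2 hF', fun h => hne (by rw [h]), x', ?_⟩
      exact glueMap_injective (hf j) hx'
    · obtain ⟨hp, hq, heq⟩ := mem_of_glueMap_eq hij hx'
      exact Or.inl ⟨⟨edge e x, hq⟩,
        ⟨j, Finset.mem_image.2 ⟨_, hF', rfl⟩, hij, ⟨_, hp⟩, heq⟩, rfl⟩

/-- A function on one copy is restricted to `Z`, extended to `Y` by the system `f`, and lifted back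
to all other copies. Points outside `Z` in different copies are separated by a function vanishing on
`Z`, extended by zero. -/
theorem IsCopySystem.glue {A : Submodule K (X → K)} {edge : E → X → P} {g : ℕ}
    (h : IsCopySystem A edge (2 * g)) {Z : Set P} (hZ : ∀ e, {x | edge e x ∈ Z}.Subsingleton)
    (hvanish : ∀ p ∉ Z, ∃ v ∈ compatibleFunctions A edge, (∀ z ∈ Z, v z = 0) ∧ v p ≠ 0)
    {f : I → Z → Y} (hf : IsCopySystem (restrictFunctions (compatibleFunctions A edge) Z) f g) :
    IsCopySystem A (glueEdge Z f edge) (2 * g) := by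
  classical
  have hext : ∀ u ∈ compatibleFunctions (restrictFunctions (compatibleFunctions A edge) Z) f,
      ∃ v : I → P → K, ∀ i, v i ∈ compatibleFunctions A edge ∧ ∀ z : Z, v i z = u (f i z) := by
    intro u hu
    exact Classical.skolem.1 fun i => mem_restrictFunctions.1 (hu i)
  have hext' : ∀ v ∈ compatibleFunctions A edge, ∀ i, ∃ u ∈ compatibleFunctions A
      (glueEdge Z f edge), ∀ p, u (glueMap Z f i p) = v p := by
    intro v hv i
    obtain ⟨u, hu, hui⟩ := hf.extend i (fun z => v z) (mem_restrictFunctions.2 ⟨v, hv, fun _ => rfl⟩)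
    obtain ⟨w, hw⟩ := hext u hu
    have hz : ∀ j, Function.update w i v j ∈ compatibleFunctions A edge ∧
        ∀ z : Z, Function.update w i v j z = u (f j z) := by
      intro j
      by_cases hj : j = i
      · subst hj
        rw [Function.update_self]
        exact ⟨hv, fun z => (congrFun hui z).symm⟩
      · rw [Function.update_of_ne hj]
        exact hw j
    refine ⟨glueFun Z u (Function.update w i v),
      glueFun_mem (fun j => (hz j).2) (fun j => (hz j).1), fun p => ?_⟩
    rw [glueFun_glueMap (hz i).2, Function.update_self]
  have hsep_inr : ∀ (i : I) (p : ↥Zᶜ) (y : Y ⊕ (I × ↥Zᶜ)), (∀ q, y ≠ Sum.inr (i, q)) →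
      ∃ u ∈ compatibleFunctions A (glueEdge Z f edge), u (Sum.inr (i, p)) ≠ u y := by
    intro i p y hy
    obtain ⟨v, hv, hvZ, hvp⟩ := hvanish p p.2
    refine ⟨glueFun Z 0 (Function.update 0 i v), glueFun_mem ?_ ?_, ?_⟩
    · intro j z
      by_cases hj : j = i
      · subst hj
        simpa using hvZ z z.2
      · simp [Function.update_of_ne hj]
    · intro j
      by_cases hj : j = i
      · subst hj
        simpa using hv
      · rw [Function.update_of_ne hj]
        exact Submodule.zero_mem _
    · rcases y with y | ⟨j, q⟩
      · simpa [glueFun] using hvp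
      · have hj : j ≠ i := by
          rintro rfl
          exact hy q rfl
        simpa [glueFun, Function.update_of_ne hj] using hvp
  refine ⟨?_, h.locallyForest.glue h.injective hZ hf.injective hf.locallyForest, ?_, ?_⟩
  · rintro ⟨i, e⟩
    exact (glueMap_injective (hf.injective i)).comp (h.injective e)
  · rintro ⟨i, e⟩ a ha
    obtain ⟨v, hv, rfl⟩ := h.extend e a ha
    obtain ⟨u, hu, huv⟩ := hext' v hv i
    exact ⟨u, hu, funext fun x => huv _⟩
  · intro y z hyz
    rcases y with y | ⟨i, p⟩
    · rcases z with z | ⟨j, q⟩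
      · obtain ⟨u, hu, hne⟩ := hf.separates y z fun h => hyz (congrArg _ h)
        obtain ⟨v, hv⟩ := hext u hu
        exact ⟨glueFun Z u v, glueFun_mem (fun i => (hv i).2) fun i => (hv i).1, hne⟩
      · obtain ⟨u, hu, hne⟩ := hsep_inr j q (Sum.inl y) (by simp)
        exact ⟨u, hu, hne.symm⟩
    · by_cases hz : ∃ q, z = Sum.inr (i, q)
      · obtain ⟨q, rfl⟩ := hz
        obtain ⟨v, hv, hne⟩ := h.separates p q (by
          intro h
          exact hyz (by rw [Subtype.ext h]))
        obtain ⟨u, hu, huv⟩ := hext' v hv i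
        refine ⟨u, hu, ?_⟩
        have hp := huv p
        have hq := huv q
        rw [glueMap_of_notMem p.2] at hp
        rw [glueMap_of_notMem q.2] at hq
        exact fun h => hne (hp.symm.trans (h.trans hq))
      · exact hsep_inr i p z fun q h => hz ⟨q, h⟩

end Glue

/-! ### The partite construction -/

section Partite

variable {K : Type} [Field K] {X W F κ : Type}

/-- Hypergraphs without short cycles over a given family of edges `f`, such that every coloring
admits edges over all the `f i` which are simultaneously colored according to the image of their
vertices in `W`, as far as the vertices over `R` are concerned. -/
theorem exists_copySystem_over [Finite W] [Finite F] [Finite X] [Nonempty κ]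
    {A : Submodule K (X → K)} (hA : SeparatingWithConstants A) {f : F → X → W} {g₀ g : ℕ}
    (hf : IsCopySystem A f g₀)
    (ih : ∀ (X' : Type) [Finite X'] (A' : Submodule K (X' → K)), SeparatingWithConstants A' →
      ∃ (Y E : Type) (_ : Finite Y) (_ : Finite E) (edge : E → X' → Y),
        IsCopySystem A' edge g ∧ ∀ c : Y → κ, ∃ e k, ∀ x, c (edge e x) = k)
    (R : Finset W) :
    ∃ (P E : Type) (_ : Finite P) (_ : Finite E) (edge : E → X → P) (π : P → W) (b : E → F),
      (∀ e x, π (edge e x) = f (b e) x) ∧ IsCopySystem A edge (2 * g) ∧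
      ∀ c : P → κ, ∃ γ : W → κ, ∀ i, ∃ e, b e = i ∧ ∀ x, f i x ∈ R → c (edge e x) = γ (f i x) := by
  classical
  induction R using Finset.induction_on with
  -- Disjoint edges, one over each `f i`; no vertex is shared, so sparsity is automatic.
  | empty =>
    have hmem : ∀ a ∈ A, ∀ i : F, (fun q : F × X => if q.1 = i then a q.2 else 0) ∈
        compatibleFunctions A (fun (i : F) (x : X) => (i, x)) := by
      intro a ha i j
      by_cases hij : j = i
      · convert ha using 1
        funext x
        simp [hij]
      · convert A.zero_mem using 1
        funext x
        simp [hij]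
    refine ⟨F × X, F, inferInstance, inferInstance, fun i x => (i, x), fun q => f q.1 q.2, id,
      fun _ _ => rfl, ⟨fun i x y h => (Prod.mk.inj h).2, ?_, ?_, ?_⟩, ?_⟩
    · rintro G ⟨e, he⟩ -
      refine ⟨e, he, ?_⟩
      rintro x ⟨e', -, hne, x', hx'⟩
      exact absurd (Prod.mk.inj hx').1 hne
    · intro i a ha
      refine ⟨_, hmem a ha i, ?_⟩
      funext x
      simp
    · rintro ⟨i, x⟩ ⟨j, y⟩ hne
      by_cases hij : i = j
      · subst hij
        obtain ⟨a, ha, hxy⟩ := hA.separates x y fun h => hne (by rw [h])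
        exact ⟨_, hmem a ha i, by simpa using hxy⟩
      · exact ⟨_, hmem _ (hA.const_mem 1) i, by simp [Ne.symm hij]⟩
    · intro c
      exact ⟨fun _ => Classical.arbitrary κ, fun i => ⟨i, rfl, fun x hx => by simp at hx⟩⟩
  | insert w R hw ihR =>
    obtain ⟨P, E, _, _, edge, π, b, hπ, hsys, hcol⟩ := ihR
    set Z : Set P := {p | π p = w} with hZdef
    -- The whole fibre over `w` becomes the edge type for the sparser-by-induction system, so that
    -- some copy of `P` has its fibre monochromatic.
    obtain ⟨Y, I, _, _, f', hf', hcol'⟩ := ih Z (restrictFunctions (compatibleFunctions A edge) Z)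
      ((hA.compatibleFunctions hsys).restrict Z)
    have hπmem : ∀ u ∈ compatibleFunctions A f, u ∘ π ∈ compatibleFunctions A edge := by
      intro u hu e
      convert hu (b e) using 1
      funext x
      simp [hπ]
    have hZ : ∀ e, {x | edge e x ∈ Z}.Subsingleton := by
      intro e x hx y hy
      apply hf.injective (b e)
      rw [← hπ, ← hπ]
      exact hx.trans hy.symm
    -- Pull back a function separating `π p` from `w` and subtract its value at `w`.
    have hvanish : ∀ p ∉ Z, ∃ v ∈ compatibleFunctions A edge, (∀ z ∈ Z, v z = 0) ∧ v p ≠ 0 := by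
      intro p hp
      obtain ⟨u, hu, hne⟩ := hf.separates (π p) w hp
      refine ⟨u ∘ π - fun _ => u w, Submodule.sub_mem _ (hπmem u hu)
        ((hA.compatibleFunctions hsys).const_mem _), fun z hz => ?_, ?_⟩
      · simp [show π z = w from hz]
      · simpa [sub_eq_zero] using hne
    have hπ' : ∀ i p, Sum.elim (fun _ : Y => w) (fun q : I × ↥Zᶜ => π q.2) (glueMap Z f' i p) =
        π p := by
      intro i p
      by_cases hp : p ∈ Z
      · rw [glueMap_of_mem hp]
        exact (show π p = w from hp).symm
      · rw [glueMap_of_notMem hp]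
        rfl
    refine ⟨Y ⊕ (I × ↥Zᶜ), I × E, inferInstance, inferInstance, glueEdge Z f' edge,
      Sum.elim (fun _ => w) (fun q => π q.2), fun q => b q.2, ?_, hsys.glue hZ hvanish hf', ?_⟩
    · rintro ⟨i, e⟩ x
      exact (hπ' i _).trans (hπ e x)
    · intro c
      obtain ⟨i, k, hk⟩ := hcol' fun y => c (Sum.inl y)
      obtain ⟨γ, hγ⟩ := hcol fun p => c (glueMap Z f' i p)
      refine ⟨Function.update γ w k, fun j => ?_⟩
      obtain ⟨e, rfl, he⟩ := hγ j
      refine ⟨(i, e), rfl, fun x hx => ?_⟩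
      by_cases hxw : f (b e) x = w
      · have hmem : edge e x ∈ Z := (hπ e x).trans hxw
        rw [hxw, Function.update_self, glueEdge, glueMap_of_mem hmem]
        exact hk _
      · rw [Function.update_of_ne hxw]
        exact he x ((Finset.mem_insert.1 hx).resolve_left hxw)

/-- A sparse Ramsey theorem: there are systems of copies of `X` without short cycles such that
every coloring of the vertices has a monochromatic edge. -/
theorem exists_sparse_copySystem (κ : Type) [Finite κ] [Nonempty κ] (g : ℕ) (X : Type) [Finite X]
    (A : Submodule K (X → K)) (hA : SeparatingWithConstants A) :
    ∃ (Y E : Type) (_ : Finite Y) (_ : Finite E) (edge : E → X → Y),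
      IsCopySystem A edge g ∧ ∀ c : Y → κ, ∃ e k, ∀ x, c (edge e x) = k := by
  suffices H : ∀ n : ℕ, ∀ (X : Type) [Finite X] (A : Submodule K (X → K)),
      SeparatingWithConstants A → ∃ (Y E : Type) (_ : Finite Y) (_ : Finite E) (edge : E → X → Y),
      IsCopySystem A edge (2 ^ n) ∧ ∀ c : Y → κ, ∃ e k, ∀ x, c (edge e x) = k by
    obtain ⟨Y, E, hY, hE, edge, hsys, hcol⟩ := H g X A hA
    exact ⟨Y, E, hY, hE, edge, hsys.mono Nat.lt_two_pow_self.le, hcol⟩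
  intro n
  induction n with
  | zero =>
    intro X _ A hA
    simpa using exists_copySystem_one (κ := κ) hA
  | succ n ih =>
    intro X _ A hA
    obtain ⟨W, F, _, _, f, hf, hfcol⟩ := exists_copySystem_one (κ := κ) hA
    have := Fintype.ofFinite W
    -- With all of `W` treated, a coloring of `P` induces a coloring `γ` of `W`, to which
    -- Hales–Jewett applies; the new edges inherit their sparsity from the gluing, not from `f`.
    obtain ⟨P, E, hP, hE, edge, π, b, hπ, hsys, hcol⟩ :=
      exists_copySystem_over hA hf ih Finset.univ
    refine ⟨P, E, hP, hE, edge, by rwa [pow_succ'], fun c => ?_⟩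
    obtain ⟨γ, hγ⟩ := hcol c
    obtain ⟨i, k, hk⟩ := hfcol γ
    obtain ⟨e, -, he⟩ := hγ i
    exact ⟨e, k, fun x => (he x (Finset.mem_univ _)).trans (hk x)⟩

end Partite

/-! ### Locally forest-like graphs -/

section Graph

variable {V X Y E : Type}

/-- Every nonempty set of fewer than `g` vertices spans a vertex of degree at most one, that is, the
graph has no cycle of length less than `g`. -/
def LocallyForestGraph (G : SimpleGraph V) (g : ℕ) : Prop :=
  ∀ T : Finset V, T.Nonempty → T.card < g → ∃ v ∈ T, {a | a ∈ T ∧ G.Adj v a}.Subsingleton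

/-- If the leaf found is the prescribed vertex and has a neighbor `w`, delete it and protect `w`
instead. -/
theorem LocallyForestGraph.exists_leaf {G : SimpleGraph V} {g : ℕ} (h : LocallyForestGraph G g)
    (T : Finset V) (hT : T.Nonempty) (hcard : T.card < g) (Q : Set V) (hQ : Q.Subsingleton) :
    ∃ v ∈ T, {a | a ∈ T ∧ G.Adj v a}.Subsingleton ∧ (v ∈ Q → ∀ a ∈ T, ¬ G.Adj v a) := by
  classical
  induction T using Finset.strongInduction generalizing Q with
  | H T ih =>
    obtain ⟨v, hvT, hv⟩ := h T hT hcard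
    by_cases hok : v ∈ Q → ∀ a ∈ T, ¬ G.Adj v a
    · exact ⟨v, hvT, hv, hok⟩
    push Not at hok
    obtain ⟨hvQ, w, hwT, hvw⟩ := hok
    obtain ⟨x, hx, hsub, hxw⟩ := ih (T.erase v) (Finset.erase_ssubset hvT)
      ⟨w, Finset.mem_erase.2 ⟨hvw.ne', hwT⟩⟩
      ((Finset.card_le_card (Finset.erase_subset _ _)).trans_lt hcard) {w}
      Set.subsingleton_singleton
    obtain ⟨hxv, hxT⟩ := Finset.mem_erase.1 hx
    refine ⟨x, hxT, ?_, fun hxQ => absurd (hQ hxQ hvQ) hxv⟩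
    by_cases hadj : G.Adj x v
    · have hxw' : x = w := hv ⟨hxT, hadj.symm⟩ ⟨hwT, hvw⟩
      have hnone : ∀ a, a ∈ T → G.Adj x a → a = v := by
        intro a ha hxa
        by_contra hav
        exact hxw hxw' a (Finset.mem_erase.2 ⟨hav, ha⟩) hxa
      exact fun a ha b hb => (hnone a ha.1 ha.2).trans (hnone b hb.1 hb.2).symm
    · refine hsub.anti fun a ha => ⟨Finset.mem_erase.2 ⟨?_, ha.1⟩, ha.2⟩
      rintro rfl
      exact hadj ha.2

theorem LocallyForestGraph.le_egirth {G : SimpleGraph V} {g : ℕ} (h : LocallyForestGraph G g) :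
    (g : ℕ∞) ≤ G.egirth := by
  classical
  rw [SimpleGraph.le_egirth]
  intro a w hw
  by_contra! hlt
  have hlt : w.length < g := by exact_mod_cast hlt
  -- The tail of the support lists the vertices of the cycle without repeating the base point, so
  -- its length is that of the cycle.
  have hsupp : ∀ v, v ∈ w.support.tail.toFinset ↔ v ∈ w.support := by
    intro v
    rw [List.mem_toFinset]
    exact ⟨List.mem_of_mem_tail, fun hv => by
      rcases (SimpleGraph.Walk.mem_support_iff w).1 hv with rfl | h
      · exact SimpleGraph.Walk.end_mem_tail_support hw.not_nil
      · exact h⟩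
  have hcard : w.support.tail.toFinset.card < g := by
    refine (List.toFinset_card_le _).trans_lt ?_
    simpa using hlt
  obtain ⟨v, hv, hsub⟩ := h _ ⟨a, (hsupp a).2 w.start_mem_support⟩ hcard
  have htwo := hw.ncard_neighborSet_toSubgraph_eq_two ((hsupp v).1 hv)
  have hle : (w.toSubgraph.neighborSet v).ncard ≤ 1 := by
    have hs : (w.toSubgraph.neighborSet v).Subsingleton := by
      refine hsub.anti fun b hb => ?_
      have hb' : w.toSubgraph.Adj v b := hb
      exact ⟨(hsupp b).2 (w.mem_verts_toSubgraph.1 hb'.snd_mem), hb'.adj_sub⟩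
    exact (Set.ncard_le_one hs.finite).2 fun a ha b hb => hs ha hb
  omega

/-- The graph obtained from disjoint copies of `G`, one for each hyperedge `e`, by joining each
vertex `y` of the hypergraph to the vertices of the copies that are placed at `y`. -/
def hubGraph (G : SimpleGraph X) (edge : E → X → Y) : SimpleGraph (Y ⊕ (E × X)) where
  Adj
    | Sum.inl _, Sum.inl _ => False
    | Sum.inl y, Sum.inr q => edge q.1 q.2 = y
    | Sum.inr q, Sum.inl y => edge q.1 q.2 = y
    | Sum.inr q, Sum.inr r => q.1 = r.1 ∧ G.Adj q.2 r.2
  symm := ⟨by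
    rintro (y | q) (z | r) h
    · exact h
    · exact h
    · exact h
    · exact ⟨h.1.symm, h.2.symm⟩⟩
  loopless := ⟨by
    rintro (y | q) h
    · exact h
    · exact G.irrefl h.2⟩

/-- Take a leaf `e` among the hyperedges whose copies meet `T`. A hub of `T` on `e` alone has only
one possible neighbor. If there is none, at most one vertex of the copy still sees a hub in `T`, and
a leaf of the copy chosen with respect to that vertex has degree at most one. -/
theorem LocallyForestGraph.hubGraph {G : SimpleGraph X} {g : ℕ} (hG : LocallyForestGraph G g)
    {edge : E → X → Y} (hinj : ∀ e, Function.Injective (edge e)) (hedge : LocallyForest edge g) :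
    LocallyForestGraph (hubGraph G edge) g := by
  classical
  intro T hT hcard
  set F : Finset E := T.toRight.image Prod.fst with hF
  have hFT : ∀ q, Sum.inr q ∈ T → q.1 ∈ F := fun q hq =>
    Finset.mem_image_of_mem _ (Finset.mem_toRight.2 hq)
  have hTr : T.toRight.card ≤ T.card := Finset.card_toRight_le
  rcases F.eq_empty_or_nonempty with hF0 | hFne
  · obtain ⟨v, hv⟩ := hT
    have hnone : ∀ q, Sum.inr q ∉ T := fun q hq => by simpa [hF0] using hFT q hq
    refine ⟨v, hv, ?_⟩
    rintro (a | a) ⟨haT, ha⟩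
    · rcases v with v | v
      · exact ha.elim
      · exact absurd hv (hnone v)
    · exact absurd haT (hnone a)
  obtain ⟨e, heF, he⟩ := hedge F hFne ((Finset.card_image_le.trans hTr).trans hcard.le)
  by_cases hhub : ∃ x, Sum.inl (edge e x) ∈ T ∧ ¬ IsSharedVertex edge F e x
  · obtain ⟨x, hxT, hx⟩ := hhub
    have huniq : ∀ a ∈ T, (_root_.hubGraph G edge).Adj (Sum.inl (edge e x)) a →
        a = Sum.inr (e, x) := by
      rintro (a | ⟨e', x'⟩) haT ha
      · exact ha.elim
      · have ha' : edge e' x' = edge e x := ha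
        by_cases hee : e' = e
        · subst hee
          rw [hinj _ ha']
        · exact absurd ⟨e', hFT _ haT, hee, x', ha'⟩ hx
    exact ⟨_, hxT, fun a ha b hb => (huniq a ha.1 ha.2).trans (huniq b hb.1 hb.2).symm⟩
  · push Not at hhub
    set U : Finset X := (T.toRight.filter fun q => q.1 = e).image Prod.snd with hU
    have hUT : ∀ x, x ∈ U ↔ Sum.inr (e, x) ∈ T := by
      intro x
      simp [hU]
    have hUne : U.Nonempty := by
      obtain ⟨⟨e, x⟩, hq, rfl⟩ := Finset.mem_image.1 heF
      exact ⟨x, (hUT x).2 (Finset.mem_toRight.1 hq)⟩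
    have hUcard : U.card < g :=
      ((Finset.card_image_le.trans (Finset.card_filter_le _ _)).trans hTr).trans_lt hcard
    obtain ⟨x, hxU, hsub, hxQ⟩ := hG.exists_leaf U hUne hUcard _ he
    refine ⟨Sum.inr (e, x), (hUT x).1 hxU, ?_⟩
    have hin : ∀ q, Sum.inr q ∈ T → (_root_.hubGraph G edge).Adj (Sum.inr (e, x)) (Sum.inr q) →
        q.1 = e ∧ q.2 ∈ U ∧ G.Adj x q.2 := by
      rintro ⟨e', x'⟩ hq ⟨hee, hadj⟩
      obtain rfl : e = e' := hee
      exact ⟨rfl, (hUT x').2 hq, hadj⟩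
    have hmix : ∀ y q, Sum.inl y ∈ T → Sum.inr q ∈ T →
        (_root_.hubGraph G edge).Adj (Sum.inr (e, x)) (Sum.inl y) →
        ¬ (_root_.hubGraph G edge).Adj (Sum.inr (e, x)) (Sum.inr q) := by
      intro y q hy hq hxy hxq
      obtain rfl : edge e x = y := hxy
      exact hxQ (hhub x hy) _ (hin q hq hxq).2.1 (hin q hq hxq).2.2
    rintro (y | q) ⟨haT, ha⟩ (z | r) ⟨hbT, hb⟩
    · have h1 : edge e x = y := ha
      have h2 : edge e x = z := hb
      rw [← h1, ← h2]
    · exact absurd hb (hmix y r haT hbT ha)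
    · exact absurd ha (hmix z q hbT haT hb)
    · obtain ⟨hq1, hq2⟩ := hin q haT ha
      obtain ⟨hr1, hr2⟩ := hin r hbT hb
      rw [Prod.ext (hq1.trans hr1.symm) (hsub hq2 hr2)]

/-- The copy over a monochromatic edge of hubs cannot use the color of those hubs. -/
theorem colorable_of_hubGraph_colorable {G : SimpleGraph X} {edge : E → X → Y} {k : ℕ}
    (hmono : ∀ c : Y → Fin (k + 1), ∃ e i, ∀ x, c (edge e x) = i)
    (h : (hubGraph G edge).Colorable (k + 1)) : G.Colorable k := by
  obtain ⟨C⟩ := h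
  obtain ⟨e, i, hi⟩ := hmono fun y => C (Sum.inl y)
  have hne : ∀ x, C (Sum.inr (e, x)) ≠ i := by
    intro x hx
    have hadj : (hubGraph G edge).Adj (Sum.inr (e, x)) (Sum.inl (edge e x)) := rfl
    exact C.valid hadj (hx.trans (hi x).symm)
  let C' : G.Coloring {j : Fin (k + 1) // j ≠ i} :=
    SimpleGraph.Coloring.mk (fun x => ⟨C (Sum.inr (e, x)), hne x⟩) fun {x y} hxy heq =>
      C.valid (show (hubGraph G edge).Adj (Sum.inr (e, x)) (Sum.inr (e, y)) from ⟨rfl, hxy⟩)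
        (congrArg Subtype.val heq)
  simpa using C'.colorable

end Graph

/-! ### Lines as uniformly moving points of the plane -/

section MovingPoints

open ComplexConjugate

variable {X Y E : Type}

/-- The position at time `t` of the point of the complex plane that starts at `l.1` and moves with
constant velocity `l.2`. -/
noncomputable def position (l : ℂ × ℂ) (t : ℝ) : ℂ := l.1 + t * l.2

/-- Two moving points are adjacent if they collide at some time. -/
def collisionGraph (l : X → ℂ × ℂ) : SimpleGraph X where
  Adj x y := x ≠ y ∧ ∃ t, position (l x) t = position (l y) t
  symm := ⟨fun _ _ h => ⟨h.1.symm, h.2.imp fun _ => Eq.symm⟩⟩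
  loopless := ⟨fun _ h => h.1 rfl⟩

/-- Each condition excludes one real line of values of `m`, and finitely many lines do not cover the
plane. -/
theorem exists_im_mul_conj_ne {ι : Type} [Finite ι] (δ : ι → ℂ) (r : ι → ℝ) (hδ : ∀ i, δ i ≠ 0) :
    ∃ m : ℂ, ∀ i, (m * conj (δ i)).im ≠ r i := by
  obtain ⟨ω, hω⟩ := Module.Dual.exists_forall_ne_zero_of_forall_exists
    (fun i => Complex.imLm ∘ₗ LinearMap.mulRight ℝ (conj (δ i))) fun i => ⟨Complex.I * δ i, by
      simpa [mul_assoc, Complex.mul_conj] using hδ i⟩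
  obtain ⟨s, hs⟩ := (Set.finite_range fun i => r i / (ω * conj (δ i)).im).infinite_compl.nonempty
  refine ⟨s * ω, fun i h => hs ⟨i, ?_⟩⟩
  have hω' : (ω * conj (δ i)).im ≠ 0 := hω i
  rw [mul_assoc, Complex.im_ofReal_mul] at h
  exact (eq_div_of_mul_eq hω' h).symm

theorem exists_sub_notMem {ι : Type} [Finite ι] {B : Set ℝ} (hB : B.Finite) :
    ∃ t : ι → ℝ, ∀ i j, i ≠ j → t i - t j ∉ B := by
  obtain ⟨n, ⟨f⟩⟩ := Finite.exists_equiv_fin ι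
  obtain ⟨R, hR⟩ := hB.isBounded.exists_norm_le
  -- Distinct multiples of a step exceeding the bound of `B` differ by more than that bound.
  refine ⟨fun i => (|R| + 1) * (f i : ℕ), fun i j hij hmem => ?_⟩
  have hne : ((f i : ℕ) : ℤ) - (f j : ℕ) ≠ 0 := by
    rw [sub_ne_zero]
    exact_mod_cast fun h => hij (f.injective (Fin.ext h))
  have hone : (1 : ℝ) ≤ |((f i : ℕ) : ℝ) - (f j : ℕ)| := by
    exact_mod_cast Int.one_le_abs hne
  have := hR _ hmem
  rw [← mul_sub, Real.norm_eq_abs, abs_mul, abs_of_pos (by positivity)] at this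
  nlinarith [le_abs_self R, abs_nonneg R]

/-- Moving the time origin, one may assume that all the starting points are distinct. -/
theorem exists_collisionGraph_eq_of_injective [Finite X] {l : X → ℂ × ℂ}
    (hl : Function.Injective l) : ∃ l' : X → ℂ × ℂ, Function.Injective (fun x => (l' x).1) ∧
      collisionGraph l' = collisionGraph l := by
  have hbad : (⋃ q : {q : X × X // q.1 ≠ q.2},
      {t | position (l q.1.1) t = position (l q.1.2) t}).Finite := by
    -- Two distinct moving points collide at most once.
    refine Set.finite_iUnion fun q => Set.Subsingleton.finite fun s hs t ht => ?_
    by_contra hst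
    have hst' : (s : ℂ) - t ≠ 0 := sub_ne_zero.2 (by exact_mod_cast hst)
    simp only [position, Set.mem_ofPred_eq] at hs ht
    have h2 : (l q.1.1).2 = (l q.1.2).2 := mul_left_cancel₀ hst' (by linear_combination hs - ht)
    have h1 : (l q.1.1).1 = (l q.1.2).1 := by
      rw [h2] at hs
      exact add_right_cancel hs
    exact q.2 (hl (Prod.ext h1 h2))
  obtain ⟨s, hs⟩ := hbad.infinite_compl.nonempty
  refine ⟨fun x => (position (l x) s, (l x).2), fun x y hxy => ?_, ?_⟩
  · by_contra hne
    exact hs (Set.mem_iUnion.2 ⟨⟨(x, y), hne⟩, hxy⟩)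
  · have hpos : ∀ x t, position (position (l x) s, (l x).2) t = position (l x) (s + t) := by
      intro x t
      simp only [position]
      push_cast
      ring
    ext x y
    refine and_congr_right fun _ => ?_
    simp only [hpos]
    exact ⟨fun ⟨t, ht⟩ => ⟨_, ht⟩, fun ⟨t, ht⟩ => ⟨t - s, by simpa using ht⟩⟩

theorem separatingWithConstants_span {p : X → ℂ} (hp : Function.Injective p) :
    SeparatingWithConstants (Submodule.span ℂ {1, p}) := by
  refine ⟨fun c => Submodule.mem_span_pair.2 ⟨c, 0, ?_⟩, fun x y hxy =>
    ⟨p, Submodule.subset_span (by simp), hp.ne hxy⟩⟩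
  funext x
  simp

/-- Placing copies of a family of moving points at the edges of a system of copies. -/
theorem exists_collisionGraph_eq_hubGraph [Finite X] [Nontrivial X] [Finite Y] [Finite E]
    {l : X → ℂ × ℂ} {edge : E → X → Y} {g : ℕ}
    (h : IsCopySystem (Submodule.span ℂ {1, fun x => (l x).1}) edge g) :
    ∃ l' : Y ⊕ (E × X) → ℂ × ℂ, Function.Injective l' ∧
      collisionGraph l' = hubGraph (collisionGraph l) edge := by
  obtain ⟨u, hu, hu_ne⟩ := Module.Dual.exists_forall_mem_ne_zero_of_forall_exists
    (compatibleFunctions (Submodule.span ℂ {1, fun x => (l x).1}) edge)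
    (fun q : {q : Y × Y // q.1 ≠ q.2} =>
      LinearMap.proj (R := ℂ) (φ := fun _ : Y => ℂ) q.1.1 - LinearMap.proj q.1.2) (by
    rintro ⟨⟨y, z⟩, hyz⟩
    obtain ⟨u, hu, hne⟩ := h.separates y z hyz
    exact ⟨u, hu, sub_ne_zero.2 hne⟩)
  have hu_inj : Function.Injective u := by
    intro y z hyz
    by_contra hne
    exact hu_ne ⟨(y, z), hne⟩ (sub_eq_zero.2 hyz)
  have haff : ∀ e, ∃ a b : ℂ, ∀ x, u (edge e x) = a + b * (l x).1 := by
    intro e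
    obtain ⟨a, b, hab⟩ := Submodule.mem_span_pair.1 (hu e)
    exact ⟨a, b, fun x => by simpa using (congrFun hab x).symm⟩
  choose a b hab using haff
  have hb : ∀ e, b e ≠ 0 := by
    intro e hbe
    obtain ⟨x, y, hxy⟩ := exists_pair_ne X
    refine hxy (h.injective e (hu_inj ?_))
    rw [hab, hab, hbe, zero_mul, zero_mul]
  set c : E × X → ℂ := fun q => b q.1 * (l q.2).2 with hc
  -- Three generic conditions on the velocities `c q + m`: none points along the displacement to a
  -- foreign hub, none is real, and no two with different `c` are parallel.
  obtain ⟨m, hm⟩ := exists_im_mul_conj_ne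
    (ι := {q : (E × X) × Y // q.2 ≠ edge q.1.1 q.1.2} ⊕ (E × X) ⊕
      {q : (E × X) × (E × X) // c q.1 ≠ c q.2})
    (Sum.elim (fun q => u q.1.2 - u (edge q.1.1.1 q.1.1.2))
      (Sum.elim (fun _ => 1) fun q => c q.1.2 - c q.1.1))
    (Sum.elim (fun q => -(c q.1.1 * conj (u q.1.2 - u (edge q.1.1.1 q.1.1.2))).im)
      (Sum.elim (fun q => -(c q).im) fun q => -(c q.1.1 * conj (c q.1.2)).im)) (by
    rintro (q | q | q)
    · exact sub_ne_zero.2 (hu_inj.ne q.2)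
    · exact one_ne_zero
    · exact sub_ne_zero.2 q.2.symm)
  have hm1 : ∀ e x y, y ≠ edge e x → ∀ t : ℝ, t * (c (e, x) + m) ≠ u y - u (edge e x) := by
    intro e x y hy t ht
    have h1 := hm (Sum.inl ⟨((e, x), y), hy⟩)
    simp only [Sum.elim_inl] at h1
    rw [← ht] at h1
    apply h1
    simp only [map_mul, Complex.conj_ofReal, map_add, Complex.mul_im, Complex.mul_re,
      Complex.add_re, Complex.add_im, Complex.conj_re, Complex.conj_im, Complex.ofReal_re,
      Complex.ofReal_im]
    ring
  have hm2 : ∀ q, c q + m ≠ 0 := by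
    intro q h0
    have h1 := hm (Sum.inr (Sum.inl q))
    simp only [Sum.elim_inl, Sum.elim_inr, map_one, mul_one] at h1
    have h2 := congrArg Complex.im h0
    rw [Complex.add_im, Complex.zero_im] at h2
    exact h1 (by linarith)
  have hm3 : ∀ q r, c q ≠ c r → ((c q + m) * conj (c r + m)).im ≠ 0 := by
    intro q r hqr h0
    have h1 := hm (Sum.inr (Sum.inr ⟨(q, r), hqr⟩))
    simp only [Sum.elim_inr] at h1
    apply h1
    simp only [map_add, map_sub, Complex.mul_im, Complex.add_re, Complex.add_im, Complex.sub_re,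
      Complex.sub_im, Complex.conj_re, Complex.conj_im] at h0 ⊢
    linarith
  -- For each pair of moving points at most one relative delay leads to a collision: equal
  -- velocities determine the delay, and non-parallel ones determine the meeting point.
  have hbad : (⋃ q : (E × X) × (E × X), {d : ℝ | ∃ t : ℝ,
      u (edge q.1.1 q.1.2) + t * (c q.1 + m) = u (edge q.2.1 q.2.2) + (t + d) * (c q.2 + m)}).Finite
      := by
    refine Set.finite_iUnion fun q => Set.Subsingleton.finite ?_
    rintro d ⟨s, hs⟩ d' ⟨s', hs'⟩
    have hdiff : ((s - s' : ℝ) : ℂ) * (c q.1 + m) = ((s - s' + (d - d') : ℝ) : ℂ) * (c q.2 + m) := by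
      push_cast
      linear_combination hs - hs'
    by_cases hcc : c q.1 = c q.2
    · rw [hcc] at hdiff
      have h1 : s - s' = s - s' + (d - d') := by
        exact_mod_cast mul_right_cancel₀ (hm2 q.2) hdiff
      linarith
    · have h1 : ((s - s' : ℝ) : ℂ) * ((c q.1 + m) * conj (c q.2 + m)) =
          ((s - s' + (d - d') : ℝ) : ℂ) * (Complex.normSq (c q.2 + m) : ℝ) := by
        rw [← mul_assoc, hdiff, mul_assoc, Complex.mul_conj]
      have h2 := congrArg Complex.im h1
      rw [Complex.im_ofReal_mul, ← Complex.ofReal_mul, Complex.ofReal_im] at h2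
      have h3 : s - s' = 0 := (mul_eq_zero.1 h2).resolve_right (hm3 _ _ hcc)
      rw [h3, Complex.ofReal_zero, zero_mul] at hdiff
      have h4 : (0 : ℝ) + (d - d') = 0 := by
        exact_mod_cast (mul_eq_zero.1 hdiff.symm).resolve_right (hm2 q.2)
      linarith
  obtain ⟨t, ht⟩ := exists_sub_notMem (ι := E) hbad
  -- Hubs stand still; the copy `e` passes through its hubs at time `t e`.
  set l' : Y ⊕ (E × X) → ℂ × ℂ := Sum.elim (fun y => (u y, 0))
    (fun q => (u (edge q.1 q.2) - t q.1 * (c q + m), c q + m)) with hl'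
  have pos_inl : ∀ y s, position (l' (Sum.inl y)) s = u y := by
    intro y s
    simp [l', position]
  have pos_inr : ∀ e x s, position (l' (Sum.inr (e, x))) (t e + s) =
      u (edge e x) + s * (c (e, x) + m) := by
    intro e x s
    simp only [l', position, Sum.elim_inr]
    push_cast
    ring
  have hub : ∀ e x y, (∃ s, position (l' (Sum.inr (e, x))) s = position (l' (Sum.inl y)) s) ↔
      edge e x = y := by
    intro e x y
    constructor
    · rintro ⟨s, hs⟩
      by_contra hne
      rw [← add_sub_cancel (t e) s, pos_inr, pos_inl] at hs
      exact hm1 e x y (Ne.symm hne) (s - t e) (by rw [← hs]; ring)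
    · rintro rfl
      refine ⟨t e + 0, ?_⟩
      rw [pos_inr, pos_inl]
      simp
  have copy : ∀ e x y, (∃ s, position (l' (Sum.inr (e, x))) s = position (l' (Sum.inr (e, y))) s) ↔
      ∃ s, position (l x) s = position (l y) s := by
    intro e x y
    -- Inside a copy the translation `a e` and the extra velocity `m` cancel in differences, which
    -- are therefore scaled by `b e`.
    have key : ∀ s : ℝ, position (l' (Sum.inr (e, x))) (t e + s) =
        position (l' (Sum.inr (e, y))) (t e + s) ↔ position (l x) s = position (l y) s := by
      intro s
      rw [pos_inr, pos_inr, hab, hab, ← sub_eq_zero, ← sub_eq_zero (a := position (l x) s)]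
      have : a e + b e * (l x).1 + s * (c (e, x) + m) - (a e + b e * (l y).1 + s * (c (e, y) + m))
          = b e * (position (l x) s - position (l y) s) := by
        simp only [hc, position]
        ring
      rw [this, mul_eq_zero, or_iff_right (hb e)]
    exact ⟨fun ⟨s, hs⟩ => ⟨s - t e, (key _).1 (by simpa using hs)⟩,
      fun ⟨s, hs⟩ => ⟨_, (key s).2 hs⟩⟩
  have cross : ∀ e x e' y s, position (l' (Sum.inr (e, x))) s = position (l' (Sum.inr (e', y))) s →
      e = e' := by
    intro e x e' y s hs
    by_contra hne
    refine ht e e' hne (Set.mem_iUnion.2 ⟨((e, x), (e', y)), s - t e, ?_⟩)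
    have h1 := pos_inr e x (s - t e)
    have h2 := pos_inr e' y (s - t e')
    rw [add_sub_cancel] at h1 h2
    rw [h1, h2] at hs
    simp only
    rw [hs]
    push_cast
    ring
  refine ⟨l', ?_, ?_⟩
  · rintro (y | ⟨e, x⟩) (z | ⟨e', x'⟩) heq
    · rw [hu_inj (congrArg Prod.fst heq : u y = u z)]
    · exact absurd (congrArg Prod.snd heq : (0 : ℂ) = c (e', x') + m).symm (hm2 _)
    · exact absurd (congrArg Prod.snd heq : c (e, x) + m = (0 : ℂ)) (hm2 _)
    · obtain rfl := cross e x e' x' 0 (by rw [heq])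
      have h1 := pos_inr e x 0
      have h2 := pos_inr e x' 0
      rw [heq, h2, Complex.ofReal_zero, zero_mul, zero_mul, add_zero, add_zero] at h1
      rw [h.injective e (hu_inj h1)]
  · ext v w
    rcases v with y | ⟨e, x⟩ <;> rcases w with z | ⟨e', x'⟩
    · refine iff_of_false ?_ id
      rintro ⟨hne, s, hs⟩
      rw [pos_inl, pos_inl] at hs
      exact hne (by rw [hu_inj hs])
    · rw [SimpleGraph.adj_comm]
      exact (and_iff_right (by simp)).trans (hub e' x' y)
    · exact (and_iff_right (by simp)).trans (hub e x z)
    · constructor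
      · rintro ⟨hne, s, hs⟩
        obtain rfl := cross _ _ _ _ _ hs
        exact ⟨rfl, fun h => hne (congrArg (fun z => Sum.inr (e, z)) h), (copy e x x').1 ⟨s, hs⟩⟩
      · rintro ⟨hee, hne, hs⟩
        obtain rfl : e = e' := hee
        exact ⟨fun h => hne (Prod.mk.inj (Sum.inr.inj h)).2, (copy e x x').2 hs⟩

/-- Moving points whose collision graph has large girth and large chromatic number. -/
theorem exists_movingPoints (g k : ℕ) : ∃ (X : Type) (_ : Finite X) (_ : Nontrivial X)
    (l : X → ℂ × ℂ), Function.Injective (fun x => (l x).1) ∧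
      LocallyForestGraph (collisionGraph l) g ∧ ¬ (collisionGraph l).Colorable k := by
  induction k with
  | zero =>
    -- Two stationary points rather than one: nontriviality is what later forces the scaling factors
    -- `b e` to be nonzero.
    refine ⟨Bool, inferInstance, inferInstance, fun x => (if x then 1 else 0, 0), ?_, ?_, ?_⟩
    · intro x y
      cases x <;> cases y <;> simp
    · rintro T ⟨v, hv⟩ -
      refine ⟨v, hv, ?_⟩
      rintro a ⟨-, hne, t, ht⟩
      exfalso
      revert hne ht
      cases v <;> cases a <;> simp [position]
    · rintro ⟨C⟩
      exact (C true).elim0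
  | succ k ih =>
    obtain ⟨X, _, _, l, hl, hforest, hcol⟩ := ih
    obtain ⟨Y, E, _, _, edge, hsys, hmono⟩ := exists_sparse_copySystem (Fin (k + 1)) g X
      (Submodule.span ℂ {1, fun x => (l x).1}) (separatingWithConstants_span hl)
    obtain ⟨l₁, hl₁, hG₁⟩ := exists_collisionGraph_eq_hubGraph hsys
    -- The next round needs distinct starting points, so that they and the constants separate
    -- points; a shift of time provides them.
    obtain ⟨l₂, hl₂, hG₂⟩ := exists_collisionGraph_eq_of_injective hl₁
    obtain ⟨e, -⟩ := hmono fun _ => 0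
    have hnt : Nontrivial (Y ⊕ (E × X)) :=
      Function.Injective.nontrivial (f := fun x : X => (Sum.inr (e, x) : Y ⊕ (E × X)))
        fun x y hxy => (Prod.mk.inj (Sum.inr.inj hxy)).2
    refine ⟨Y ⊕ (E × X), inferInstance, hnt, l₂, hl₂, ?_, ?_⟩
    · rw [hG₂, hG₁]
      exact hforest.hubGraph hsys.injective hsys.locallyForest
    · rw [hG₂, hG₁]
      exact fun h => hcol (colorable_of_hubGraph_colorable hmono h)

end MovingPoints

/-! ### Lines in space -/

section Lines

/-- The line in space traced out in space-time by a moving point of the plane. -/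
noncomputable def worldLine (l : ℂ × ℂ) : Set (EuclideanSpace ℝ (Fin 3)) :=
  Set.range fun t : ℝ => !₂[(position l t).re, (position l t).im, t]

theorem mem_worldLine {l : ℂ × ℂ} {x : EuclideanSpace ℝ (Fin 3)} :
    x ∈ worldLine l ↔ x 0 = (position l (x 2)).re ∧ x 1 = (position l (x 2)).im := by
  constructor
  · rintro ⟨t, rfl⟩
    simp
  · rintro ⟨h0, h1⟩
    refine ⟨x 2, ?_⟩
    ext i
    fin_cases i <;> simp [h0, h1]

theorem isStraightLine_worldLine (l : ℂ × ℂ) : IsStraightLine (worldLine l) := by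
  refine ⟨!₂[l.1.re, l.1.im, 0], !₂[(l.1 + l.2).re, (l.1 + l.2).im, 1], fun h => ?_, ?_⟩
  · simpa using congrArg (fun x : EuclideanSpace ℝ (Fin 3) => x 2) h
  · ext x
    rw [SetLike.mem_coe, mem_affineSpan_pair_iff_exists_lineMap_eq]
    refine exists_congr fun t => ?_
    suffices h : !₂[(position l t).re, (position l t).im, t] = AffineMap.lineMap
        (!₂[l.1.re, l.1.im, 0] : EuclideanSpace ℝ (Fin 3))
        !₂[(l.1 + l.2).re, (l.1 + l.2).im, 1] t by
      exact Eq.congr_left h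
    ext i
    fin_cases i <;> simp [AffineMap.lineMap_apply, position] <;> ring

theorem inter_worldLine_nonempty {l l' : ℂ × ℂ} :
    (worldLine l ∩ worldLine l').Nonempty ↔ ∃ t, position l t = position l' t := by
  constructor
  · rintro ⟨x, hx, hx'⟩
    rw [mem_worldLine] at hx hx'
    exact ⟨x 2, Complex.ext (hx.1.symm.trans hx'.1) (hx.2.symm.trans hx'.2)⟩
  · rintro ⟨t, ht⟩
    exact ⟨_, ⟨t, rfl⟩, t, by simp only [ht]⟩

theorem fst_eq_of_worldLine_eq {l l' : ℂ × ℂ} (h : worldLine l = worldLine l') : l.1 = l'.1 := by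
  have hmem : !₂[(position l 0).re, (position l 0).im, (0 : ℝ)] ∈ worldLine l' := h ▸ ⟨0, rfl⟩
  rw [mem_worldLine] at hmem
  simpa [position, Complex.ext_iff] using hmem

/-- The intersection graph of the lines traced out by moving points is their collision graph. -/
noncomputable def collisionGraphIso {X : Type} {l : X → ℂ × ℂ}
    (hl : Function.Injective fun x => (l x).1) :
    collisionGraph l ≃g intersectionGraph (Set.range fun x => worldLine (l x)) where
  toEquiv := Equiv.ofInjective _ fun _ _ h => hl (fst_eq_of_worldLine_eq h)
  map_rel_iff' := by
    intro x y
    refine and_congr ?_ inter_worldLine_nonempty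
    exact (EmbeddingLike.apply_eq_iff_eq _).not

end Lines

theorem mainTheorem2 (g k : ℕ) (hg : 3 ≤ g) (hk : 1 ≤ k) :
    ∃ S : Set (Set (EuclideanSpace ℝ (Fin 3))),
      S.Finite ∧
      (∀ L ∈ S, IsStraightLine L) ∧
      (g : ℕ∞) ≤ (intersectionGraph S).egirth ∧
      (k : ℕ∞) ≤ (intersectionGraph S).chromaticNumber := by
  obtain ⟨X, _, _, l, hl, hforest, hcol⟩ := exists_movingPoints g k
  refine ⟨Set.range fun x => worldLine (l x), Set.finite_range _, ?_, ?_, ?_⟩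
  · rintro _ ⟨x, rfl⟩
    exact isStraightLine_worldLine _
  · rw [← (collisionGraphIso hl).egirth_eq]
    exact hforest.le_egirth
  · rw [SimpleGraph.le_chromaticNumber_iff_colorable]
    intro m hm
    by_contra! hlt
    exact hcol ((hm.of_hom (collisionGraphIso hl).toHom).mono (by exact_mod_cast hlt.le))
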